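/- Fix $L,\alpha,\beta>0$ and put $k=2\pi/L$. A rotating fluxon wave with frequency $\omega\in\mathbb R$ (for a bias $\gamma>0$) is a classical solution $\phi(x,t)$, $(x,t)\in\mathbb R^2$, of $$\phi_{tt}+\alpha\phi_t+\sin\phi=\phi_{xx}+\beta\phi_{xxt}+\gamma,\qquad \phi(x+L,t)=\phi(x,t)+2\pi,$$ of the form $\phi(x,t)=\theta(\kappa x+\omega t)$ for some $\kappa\in\mathbb R$ and some $\theta:\mathbb R\to\mathbb R$ with $\theta(z+2\pi)=\theta(z)+2\pi$ for all $z$. (1) There is $\gamma_0>0$, depending only on $L,\alpha,\beta$, such that for every $\gamma>\gamma_0$ there is exactly one rotating fluxon wave up to time translation: a rotating fluxon wave $\phi$ with a frequency $\omega>0$ exists, and every rotating fluxon wave $\phi'$, with any frequency $\omega'\in\mathbb R$, has $\omega'=\omega$ and $\phi'(x,t)=\phi(x,t+\tau)$ for some $\tau\in\mathbb R$ and all $x,t$. (2) Write $\langle f\rangle=\frac1{2\pi}\int_0^{2\pi}f(s)\,ds$ and let $X$ be the space of $2\pi$-periodic functions $u:\mathbb R\to\mathbb R$ of class $H^3$ (that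 is, $u\in C^2$ and $u''$ is absolutely continuous on $[0,2\pi]$ with derivative $u'''\in L^2(0,2\pi)$) with $\langle u\rangle=0$. There is $\lambda_1>0$ such that for every $\lambda\in(0,\lambda_1)$ there is exactly one $u=u_\lambda\in X$ with $$\beta k^2u'''(z)+\Big(\lambda k^2-\frac1\lambda\Big)u''(z)-\alpha u'(z)=\lambda\big(\sin(z+u(z))-\langle \sin(s+u(s))\rangle\big)\quad\text{for a.e. } z\in(0,2\pi),$$ and the function $\Psi(\lambda)=\frac{\alpha}{\lambda}+\langle\sin(s+u_\lambda(s))\rangle$ is strictly decreasing on $(0,\lambda_1)$. -/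

import Mathlib

open MeasureTheory Set

/-- `φ x t` is a classical solution on the whole `(x, t)`-plane of
`φ_tt + α φ_t + sin φ = φ_xx + β φ_xxt + γ`: the partial derivatives which occur in the equation
exist everywhere, and the equation holds everywhere. -/
def IsJosephsonSolution (α β γ : ℝ) (φ : ℝ → ℝ → ℝ) : Prop :=
  ∃ φt φtt φx φxx φxxt : ℝ → ℝ → ℝ,
    (∀ x t, HasDerivAt (fun s => φ x s) (φt x t) t) ∧
    (∀ x t, HasDerivAt (fun s => φt x s) (φtt x t) t) ∧
    (∀ x t, HasDerivAt (fun y => φ y t) (φx x t) x) ∧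
    (∀ x t, HasDerivAt (fun y => φx y t) (φxx x t) x) ∧
    (∀ x t, HasDerivAt (fun s => φxx x s) (φxxt x t) t) ∧
    ∀ x t, φtt x t + α * φt x t + Real.sin (φ x t) = φxx x t + β * φxxt x t + γ

/-- `φ` is a rotating fluxon wave with frequency `ω` on an annulus of circumference `L`: a solution
of the Josephson equation with `φ(x + L, t) = φ(x, t) + 2π`, of the form
`φ(x, t) = θ(k x + ω t)` where `θ(z + 2π) = θ(z) + 2π`. Neither the value of the wave number `k`
nor the sign of `ω` is prescribed. -/
def IsRotatingFluxonWave (L α β γ ω : ℝ) (φ : ℝ → ℝ → ℝ) : Prop :=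
  IsJosephsonSolution α β γ φ ∧
  (∀ x t, φ (x + L) t = φ x t + 2 * Real.pi) ∧
  ∃ (k : ℝ) (θ : ℝ → ℝ),
    (∀ z, θ (z + 2 * Real.pi) = θ z + 2 * Real.pi) ∧
    ∀ x t, φ x t = θ (k * x + ω * t)

/-- `u`, extended `2π`-periodically to the line, belongs to the space of mean-zero functions in
`H³[0, 2π]` with `u⁽ⁱ⁾(0) = u⁽ⁱ⁾(2π)` for `i = 0, 1, 2`, and `w` is its weak third derivative on
`[0, 2π]`: `u` is `C²`, and `u''` is absolutely continuous with derivative `w ∈ L²(0, 2π)`. -/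
structure IsPeriodicH3 (u w : ℝ → ℝ) : Prop where
  periodic : Function.Periodic u (2 * Real.pi)
  contDiff : ContDiff ℝ 2 u
  memLp : MemLp w 2 (volume.restrict (Ioc 0 (2 * Real.pi)))
  integral_third : ∀ z ∈ Icc 0 (2 * Real.pi),
    iteratedDeriv 2 u z = iteratedDeriv 2 u 0 + ∫ s in (0 : ℝ)..z, w s
  mean_zero : ∫ s in (0 : ℝ)..(2 * Real.pi), u s = 0

/-- The average `⟨sin(s + u)⟩` over a period. -/
noncomputable def meanSin (u : ℝ → ℝ) : ℝ :=
  (1 / (2 * Real.pi)) * ∫ s in (0 : ℝ)..(2 * Real.pi), Real.sin (s + u s)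

/-- `u = lam • L_lam⁻¹ (N u)`, that is, `u` is in the domain of `L_lam` and
`L_lam u = lam • N u` in `L²(0, 2π)`, where `k = 2π / L`,
`L_lam u = β k² u''' + (lam k² - 1/lam) u'' - α u'` and `N u = sin(z + u) - ⟨sin(s + u)⟩`. -/
def IsReducedFixedPoint (L α β lam : ℝ) (u : ℝ → ℝ) : Prop :=
  ∃ w : ℝ → ℝ, IsPeriodicH3 u w ∧
    ∀ᵐ z ∂(volume.restrict (Ioc 0 (2 * Real.pi))),
      β * (2 * Real.pi / L) ^ 2 * w z
        + (lam * (2 * Real.pi / L) ^ 2 - 1 / lam) * iteratedDeriv 2 u z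
        - α * deriv u z
      = lam * (Real.sin (z + u z) - meanSin u)

/-- The functional `Φ(lam, u) = α / lam + ⟨sin(s + u)⟩`. -/
noncomputable def biasFunctional (α lam : ℝ) (u : ℝ → ℝ) : ℝ :=
  α / lam + meanSin u

/-!
The proof uses sup norms and the maximum principle only.

The linear operator `u ↦ a u''' - b u'' - α u'` with `a, α > 0` is invertible on mean-zero
`2π`-periodic functions: as an operator on `v = u'` it factors over `ℝ` into two first-order
operators (`exists_isPeriodicSolution`), and the maximum principle bounds `|u'|` by `sup |f| / α`
for every real `b`, and `|u''|` by `2 sup |f| / b` for `b > 0`. Since the right-hand side of the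
reduced equation is `O(λ)` and Lipschitz in `u` with constant `2 λ`, Banach's fixed point theorem
applies for small `λ` (`exists_isReducedSolution`). A solution in the weak sense of the statement is
classical, because the equation expresses its third derivative through continuous functions.

The core is the comparison of the solutions `u`, `v` at two parameters `λ ≤ μ`
(`abs_sub_mul_le_of_isReducedSolution`). Their difference solves the linear equation with a
right-hand side that contains `(1/λ - 1/μ) v''`, where `v'' = O(μ²)`; it follows that
`|u - v| ≤ (α/λ - α/μ) / 2`. For `λ = μ` this is uniqueness. As `⟨sin(s + u)⟩` is `1`-Lipschitz
in the sup norm, the term `α/λ` dominates the variation of `Ψ`, which is therefore strictly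
decreasing, and continuous, with limit `∞` at `0`.

The periodicity conditions on a rotating wave force its wave number to be `2π / L`: otherwise
the profile minus the identity, which is continuous and periodic, would have no maximum. For
`γ > 1` a static profile would be strictly concave with a periodic derivative, so `ω ≠ 0`. Averaging
the profile equation gives `α ω + ⟨sin(s + u)⟩ = γ`, where `u` is the deviation from the identity of
a translate of the profile. Thus `ω > 0`, the function `u` solves the reduced equation with
`λ = 1 / ω`, and `Ψ(λ) = γ` (`IsRotatingFluxonWave.exists_isReducedSolution`); for large `γ` this
`λ` is small. The converse is a direct computation. Hence rotating waves up to time translation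
correspond to solutions of `Ψ(λ) = γ`, and for large `γ` there is exactly one.
-/

/-! ### Periodic functions and the maximum principle -/

theorem exists_forall_le_of_periodic {v : ℝ → ℝ} (hv : Function.Periodic v (2 * Real.pi))
    (hc : Continuous v) : ∃ z₀, ∀ z, v z ≤ v z₀ := by
  obtain ⟨z₀, -, h⟩ := (isCompact_Icc (a := (0 : ℝ)) (b := 2 * Real.pi)).exists_isMaxOn
    ⟨0, by simp [Real.pi_pos.le]⟩ hc.continuousOn
  refine ⟨z₀, fun z => ?_⟩
  obtain ⟨y, hy, e⟩ := hv.exists_mem_Ico₀ Real.two_pi_pos z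
  rw [e]
  exact h (Ico_subset_Icc_self hy)

theorem continuous_of_forall_hasDerivAt {v v₁ : ℝ → ℝ} (h : ∀ z, HasDerivAt v (v₁ z) z) :
    Continuous v :=
  continuous_iff_continuousAt.2 fun z => (h z).continuousAt

theorem periodic_of_hasDerivAt {v v₁ : ℝ → ℝ} {c : ℝ} (hv : Function.Periodic v c)
    (h : ∀ z, HasDerivAt v (v₁ z) z) : Function.Periodic v₁ c := fun z => by
  have h1 := (h (z + c)).comp_add_const z c
  rw [show (fun x => v (x + c)) = v from funext hv] at h1
  exact h1.unique (h z)

theorem hasDerivAt_eq_zero_of_forall_le {v v₁ : ℝ → ℝ} (h : ∀ z, HasDerivAt v (v₁ z) z) {z₀ : ℝ}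
    (hmax : ∀ z, v z ≤ v z₀) : v₁ z₀ = 0 :=
  IsLocalMax.hasDerivAt_eq_zero (Filter.Eventually.of_forall hmax) (h z₀)

theorem second_hasDerivAt_nonpos_of_forall_le {v v₁ v₂ : ℝ → ℝ}
    (h : ∀ z, HasDerivAt v (v₁ z) z) (h₁ : ∀ z, HasDerivAt v₁ (v₂ z) z) {z₀ : ℝ}
    (hmax : ∀ z, v z ≤ v z₀) : v₂ z₀ ≤ 0 := by
  by_contra! hpos
  have e : deriv v = v₁ := funext fun z => (h z).deriv
  have e₁ : deriv v₁ = v₂ := funext fun z => (h₁ z).deriv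
  have hmin : IsLocalMin v z₀ := isLocalMin_of_deriv_deriv_pos (by rwa [e, e₁])
    (by rw [e]; exact hasDerivAt_eq_zero_of_forall_le h hmax) (h z₀).continuousAt
  -- A point that is both a local minimum and a maximum has a neighbourhood where `v` is constant.
  have hconst : v =ᶠ[nhds z₀] fun _ => v z₀ := by
    filter_upwards [hmin] with z hz using le_antisymm (hmax z) hz
  have h2 := hconst.deriv.deriv_eq
  rw [e, e₁] at h2
  simp at h2
  exact hpos.ne' h2

/-- The maximum principle for `a v'' - b v' - α v = f`: at a maximum of `v`, `v' = 0` and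
`v'' ≤ 0`. The coefficient `b` is arbitrary. -/
theorem abs_le_of_second_order {a b α M : ℝ} (ha : 0 ≤ a) (hα : 0 < α) {v v₁ v₂ f : ℝ → ℝ}
    (hv : Function.Periodic v (2 * Real.pi)) (h : ∀ z, HasDerivAt v (v₁ z) z)
    (h₁ : ∀ z, HasDerivAt v₁ (v₂ z) z) (heq : ∀ z, a * v₂ z - b * v₁ z - α * v z = f z)
    (hf : ∀ z, |f z| ≤ M) (z : ℝ) : |v z| ≤ M / α := by
  have key : ∀ {v v₁ v₂ f : ℝ → ℝ}, Function.Periodic v (2 * Real.pi) →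
      (∀ z, HasDerivAt v (v₁ z) z) → (∀ z, HasDerivAt v₁ (v₂ z) z) →
      (∀ z, a * v₂ z - b * v₁ z - α * v z = f z) → (∀ z, |f z| ≤ M) → ∀ z, v z ≤ M / α := by
    intro v v₁ v₂ f hv h h₁ heq hf z
    obtain ⟨z₀, hz₀⟩ := exists_forall_le_of_periodic hv (continuous_of_forall_hasDerivAt h)
    have e1 := hasDerivAt_eq_zero_of_forall_le h hz₀
    have e2 := second_hasDerivAt_nonpos_of_forall_le h h₁ hz₀
    have e3 := heq z₀
    rw [e1] at e3
    have e4 := (abs_le.1 (hf z₀)).1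
    refine (hz₀ z).trans ?_
    rw [le_div_iff₀ hα]
    nlinarith [mul_nonneg ha (neg_nonneg.2 e2)]
  refine abs_le.2 ⟨?_, key hv h h₁ heq hf z⟩
  have := key (v := fun z => -v z) (v₁ := fun z => -v₁ z) (v₂ := fun z => -v₂ z)
    (f := fun z => -f z) (fun z => by simp [hv z]) (fun z => (h z).neg) (fun z => (h₁ z).neg)
    (fun z => by rw [← heq z]; ring) (fun z => by simpa using hf z) z
  linarith

/-- Where `|v'|` is maximal, `v'' = 0`, and the equation becomes `-b v' = f + α v`. -/
theorem abs_deriv_le_of_second_order {a b α M : ℝ} (ha : 0 ≤ a) (hb : 0 < b) (hα : 0 < α)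
    {v v₁ v₂ f : ℝ → ℝ}
    (hv : Function.Periodic v (2 * Real.pi)) (h : ∀ z, HasDerivAt v (v₁ z) z)
    (h₁ : ∀ z, HasDerivAt v₁ (v₂ z) z) (heq : ∀ z, a * v₂ z - b * v₁ z - α * v z = f z)
    (hf : ∀ z, |f z| ≤ M) (z : ℝ) : |v₁ z| ≤ 2 * M / b := by
  have hvM := abs_le_of_second_order ha hα hv h h₁ heq hf
  have hp := periodic_of_hasDerivAt hv h
  have hc := continuous_of_forall_hasDerivAt h₁
  obtain ⟨z₀, hz₀⟩ := exists_forall_le_of_periodic (v := fun z => |v₁ z|)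
    (fun z => by simp [hp z]) hc.abs
  refine (hz₀ z).trans ?_
  -- At a maximum of `|v₁|`, the square `v₁ ^ 2` is maximal, hence `v₁ * v₂ = 0` there.
  have e := hasDerivAt_eq_zero_of_forall_le (fun z => (h₁ z).pow 2) (z₀ := z₀)
    (fun z => sq_le_sq.2 (hz₀ z))
  simp only [Nat.cast_ofNat, Nat.add_one_sub_one, pow_one, mul_eq_zero, OfNat.ofNat_ne_zero,
    false_or] at e
  have hM : 0 ≤ M := (abs_nonneg _).trans (hf 0)
  rcases e with e | e
  · simp only [e, abs_zero]; positivity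
  · have e3 := heq z₀
    rw [e] at e3
    have h1 := hf z₀
    have h2 := hvM z₀
    rw [le_div_iff₀ hα] at h2
    rw [le_div_iff₀ hb]
    have : |v₁ z₀| * b = |f z₀ + α * v z₀| := by
      rw [← e3, ← abs_neg]
      nth_rw 1 [← abs_of_pos hb]
      rw [← abs_mul]; congr 1; ring
    rw [this]
    calc _ ≤ |f z₀| + |α * v z₀| := abs_add_le _ _
      _ ≤ _ := by rw [abs_mul, abs_of_pos hα]; linarith

/-- A periodic function of mean zero vanishes somewhere, so it is bounded by `2π` times a bound
for its derivative. -/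
theorem abs_le_of_mean_zero {u u₁ : ℝ → ℝ} {V : ℝ} (hp : Function.Periodic u (2 * Real.pi))
    (h : ∀ z, HasDerivAt u (u₁ z) z) (hm : ∫ s in (0 : ℝ)..(2 * Real.pi), u s = 0)
    (hV : ∀ z, |u₁ z| ≤ V) (z : ℝ) : |u z| ≤ 2 * Real.pi * V := by
  have hc := continuous_of_forall_hasDerivAt h
  have hV0 : 0 ≤ V := (abs_nonneg _).trans (hV 0)
  obtain ⟨c, hcm, hc0⟩ := exists_hasDerivAt_eq_zero (f := fun x => ∫ s in (0 : ℝ)..x, u s) (f' := u)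
    Real.two_pi_pos
    (continuous_of_forall_hasDerivAt fun x =>
      (hc.integral_hasStrictDerivAt 0 x).hasDerivAt).continuousOn
    (by simp [hm]) fun x _ => (hc.integral_hasStrictDerivAt 0 x).hasDerivAt
  obtain ⟨y, hy, e⟩ := hp.exists_mem_Ico₀ Real.two_pi_pos z
  rw [e]
  have := Convex.norm_image_sub_le_of_norm_hasDerivWithin_le (f := u) (f' := u₁) (s := univ) (C := V)
    (x := c) (y := y) (fun x _ => (h x).hasDerivWithinAt) (fun x _ => hV x) convex_univ trivial trivial
  rw [hc0, sub_zero, Real.norm_eq_abs, Real.norm_eq_abs] at this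
  refine this.trans ?_
  rw [mul_comm]
  refine mul_le_mul_of_nonneg_right (abs_le.2 ⟨?_, ?_⟩) hV0
  · linarith [hcm.2, hy.1]
  · linarith [hcm.1, hy.2]

theorem periodic_integral_of_mean_zero {g : ℝ → ℝ} (hc : Continuous g)
    (hp : Function.Periodic g (2 * Real.pi)) (hm : ∫ s in (0 : ℝ)..(2 * Real.pi), g s = 0) :
    Function.Periodic (fun x => ∫ s in (0 : ℝ)..x, g s) (2 * Real.pi) := fun z => by
  simp only
  rw [← intervalIntegral.integral_add_adjacent_intervals (hc.intervalIntegrable 0 z)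
    (hc.intervalIntegrable _ _), hp.intervalIntegral_add_eq z 0, zero_add, hm, add_zero]

/-! ### The linear problem -/

/-- `u` is a classical `2π`-periodic mean-zero solution of `a u''' - b u'' - α u' = f`, with
successive derivatives `u₁`, `u₂`, `u₃`. -/
structure IsPeriodicSolution (a b α : ℝ) (f u u₁ u₂ u₃ : ℝ → ℝ) : Prop where
  periodic : Function.Periodic u (2 * Real.pi)
  mean_zero : ∫ s in (0 : ℝ)..(2 * Real.pi), u s = 0
  hasDerivAt : ∀ z, HasDerivAt u (u₁ z) z
  hasDerivAt₁ : ∀ z, HasDerivAt u₁ (u₂ z) z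
  hasDerivAt₂ : ∀ z, HasDerivAt u₂ (u₃ z) z
  eq : ∀ z, a * u₃ z - b * u₂ z - α * u₁ z = f z

namespace IsPeriodicSolution

variable {a b b' α M : ℝ} {f g u u₁ u₂ u₃ v v₁ v₂ v₃ : ℝ → ℝ}

theorem continuous (h : IsPeriodicSolution a b α f u u₁ u₂ u₃) : Continuous u :=
  continuous_of_forall_hasDerivAt h.hasDerivAt

/-- The coefficient `b` may differ between the two equations; the discrepancy goes into the
right-hand side of the equation for the difference. -/
theorem sub (h : IsPeriodicSolution a b α f u u₁ u₂ u₃)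
    (h' : IsPeriodicSolution a b' α g v v₁ v₂ v₃) :
    IsPeriodicSolution a b α (fun z => f z - g z + (b - b') * v₂ z)
      (fun z => u z - v z) (fun z => u₁ z - v₁ z) (fun z => u₂ z - v₂ z)
      (fun z => u₃ z - v₃ z) where
  periodic z := by simp [h.periodic z, h'.periodic z]
  mean_zero := by
    rw [intervalIntegral.integral_sub (h.continuous.intervalIntegrable _ _)
      (h'.continuous.intervalIntegrable _ _), h.mean_zero, h'.mean_zero, sub_zero]
  hasDerivAt z := (h.hasDerivAt z).sub (h'.hasDerivAt z)
  hasDerivAt₁ z := (h.hasDerivAt₁ z).sub (h'.hasDerivAt₁ z)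
  hasDerivAt₂ z := (h.hasDerivAt₂ z).sub (h'.hasDerivAt₂ z)
  eq z := by rw [← h.eq z, ← h'.eq z]; ring

theorem periodic₁ (h : IsPeriodicSolution a b α f u u₁ u₂ u₃) :
    Function.Periodic u₁ (2 * Real.pi) :=
  periodic_of_hasDerivAt h.periodic h.hasDerivAt

theorem abs_le (h : IsPeriodicSolution a b α f u u₁ u₂ u₃) (ha : 0 ≤ a) (hα : 0 < α)
    (hf : ∀ z, |f z| ≤ M) (z : ℝ) : |u z| ≤ 2 * Real.pi * (M / α) :=
  abs_le_of_mean_zero h.periodic h.hasDerivAt h.mean_zero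
    (abs_le_of_second_order ha hα h.periodic₁ h.hasDerivAt₁ h.hasDerivAt₂ h.eq hf) z

theorem abs_second_le (h : IsPeriodicSolution a b α f u u₁ u₂ u₃) (ha : 0 ≤ a) (hb : 0 < b)
    (hα : 0 < α) (hf : ∀ z, |f z| ≤ M) (z : ℝ) : |u₂ z| ≤ 2 * M / b :=
  abs_deriv_le_of_second_order ha hb hα h.periodic₁ h.hasDerivAt₁ h.hasDerivAt₂ h.eq hf z

end IsPeriodicSolution

theorem exists_periodic_first_order {r : ℝ} (hr : r ≠ 0) {g : ℝ → ℝ} (hg : Continuous g)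
    (hp : Function.Periodic g (2 * Real.pi)) :
    ∃ v : ℝ → ℝ, Function.Periodic v (2 * Real.pi) ∧ ∀ z, HasDerivAt v (r * v z + g z) z := by
  set G : ℝ → ℝ := fun x => ∫ s in (0 : ℝ)..x, Real.exp (-(r * s)) * g s with hG
  have hGd : ∀ z, HasDerivAt G (Real.exp (-(r * z)) * g z) z := fun z =>
    (Continuous.integral_hasStrictDerivAt (by fun_prop) 0 z).hasDerivAt
  -- The constant is the one for which the solution takes the same value at `0` and at `2π`.
  set c : ℝ := Real.exp (r * (2 * Real.pi)) * G (2 * Real.pi) / (1 - Real.exp (r * (2 * Real.pi)))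
  have hne : 1 - Real.exp (r * (2 * Real.pi)) ≠ 0 := by
    rw [sub_ne_zero, ne_comm, Ne, Real.exp_eq_one_iff]
    exact mul_ne_zero hr Real.two_pi_pos.ne'
  have hcE : c * (1 - Real.exp (r * (2 * Real.pi))) =
      Real.exp (r * (2 * Real.pi)) * G (2 * Real.pi) := div_mul_cancel₀ _ hne
  have hexp : ∀ s z : ℝ, HasDerivAt (fun z => Real.exp (s * z)) (Real.exp (s * z) * s) z :=
    fun s z => by simpa using ((hasDerivAt_id z).const_mul s).exp
  set v : ℝ → ℝ := fun z => Real.exp (r * z) * (c + G z) with hv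
  have hvd : ∀ z, HasDerivAt v (r * v z + g z) z := fun z => by
    refine ((hexp r z).mul ((hGd z).const_add c)).congr_deriv ?_
    have : Real.exp (r * z) * Real.exp (-(r * z)) = 1 := by rw [← Real.exp_add]; simp
    simp only [hv]
    linear_combination g z * this
  have h0 : v (0 + 2 * Real.pi) = v 0 := by
    have hG0 : G 0 = 0 := by simp [hG]
    simp only [hv, hG0, zero_add, mul_zero, Real.exp_zero, add_zero, one_mul]
    linear_combination -hcE
  refine ⟨v, fun z => ?_, hvd⟩
  -- The difference `v (z + 2π) - v z` solves the homogeneous equation and vanishes at `0`.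
  have hd : ∀ z, HasDerivAt (fun z => Real.exp (-r * z) * (v (z + 2 * Real.pi) - v z)) 0 z := by
    intro z
    refine ((hexp (-r) z).mul (((hvd (z + 2 * Real.pi)).comp_add_const z _).sub
      (hvd z))).congr_deriv ?_
    simp only [Pi.sub_apply, hp z]; ring
  have hz := is_const_of_deriv_eq_zero (fun z => (hd z).differentiableAt) (fun z => (hd z).deriv) z 0
  simp only [h0, sub_self, mul_zero] at hz
  simpa [sub_eq_zero] using hz

/-- The derivative of the solution is found by factoring `a D² - b D - α` into first-order
operators, which is possible over `ℝ` because `a` and `α` are positive. It has mean zero since `f`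
has. -/
theorem exists_isPeriodicSolution {a b α : ℝ} (ha : 0 < a) (hα : 0 < α) {f : ℝ → ℝ}
    (hf : Continuous f) (hp : Function.Periodic f (2 * Real.pi))
    (hm : ∫ s in (0 : ℝ)..(2 * Real.pi), f s = 0) :
    ∃ u u₁ u₂ u₃, IsPeriodicSolution a b α f u u₁ u₂ u₃ := by
  -- `a r ^ 2 - b r - α` has real roots of opposite signs.
  obtain ⟨r, s, hrs, hrs', hr, hs⟩ :
      ∃ r s : ℝ, a * (r + s) = b ∧ a * (r * s) = -α ∧ r ≠ 0 ∧ s ≠ 0 := by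
    have hD : 0 ≤ b ^ 2 + 4 * a * α := by positivity
    have hsq := Real.mul_self_sqrt hD
    set q := Real.sqrt (b ^ 2 + 4 * a * α)
    have h2 : a * ((b + q) / (2 * a) * ((b - q) / (2 * a))) = -α := by
      field_simp; linear_combination -hsq
    refine ⟨(b + q) / (2 * a), (b - q) / (2 * a), by field_simp; ring, h2, ?_, ?_⟩ <;>
    · intro h0; rw [h0] at h2; simp at h2; exact hα.ne' h2
  obtain ⟨h, hhp, hhd⟩ := exists_periodic_first_order hr (hf.div_const a)
    (g := fun z => f z / a) (fun z => by simp [hp z])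
  obtain ⟨v, hvp, hvd⟩ := exists_periodic_first_order hs (continuous_of_forall_hasDerivAt hhd) hhp
  have hvc := continuous_of_forall_hasDerivAt hvd
  have hhc := continuous_of_forall_hasDerivAt hhd
  have hvd1 : ∀ z, HasDerivAt (fun z => s * v z + h z) (s * (s * v z + h z) + (r * h z + f z / a)) z :=
    fun z => ((hvd z).const_mul s).add (hhd z)
  have heq : ∀ z, a * (s * (s * v z + h z) + (r * h z + f z / a)) - b * (s * v z + h z) - α * v z
      = f z := by
    intro z
    rw [← hrs, ← neg_eq_iff_eq_neg.2 hrs']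
    field_simp
    ring
  have hvm : ∫ s in (0 : ℝ)..(2 * Real.pi), v s = 0 := by
    have hF : ∀ z, HasDerivAt (fun z => a * (s * v z + h z) - b * v z) (f z + α * v z) z := fun z =>
      (((hvd1 z).const_mul a).sub ((hvd z).const_mul b)).congr_deriv (by linear_combination heq z)
    have e := intervalIntegral.integral_eq_sub_of_hasDerivAt (a := 0) (b := 2 * Real.pi)
      (fun z _ => hF z) ((hf.add (hvc.const_mul α)).intervalIntegrable _ _)
    rw [intervalIntegral.integral_add (hf.intervalIntegrable _ _)
      ((hvc.const_mul α).intervalIntegrable _ _), hm, intervalIntegral.integral_const_mul,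
      ← zero_add (2 * Real.pi), hvp 0, hhp 0, sub_self, zero_add, zero_add] at e
    exact (mul_eq_zero.1 e).resolve_left hα.ne'
  have hUd : ∀ z, HasDerivAt (fun x => ∫ s in (0 : ℝ)..x, v s) (v z) z := fun z =>
    (hvc.integral_hasStrictDerivAt 0 z).hasDerivAt
  set U : ℝ → ℝ := fun x => ∫ s in (0 : ℝ)..x, v s with hU
  have hUc := continuous_of_forall_hasDerivAt hUd
  have hUp : Function.Periodic U (2 * Real.pi) := periodic_integral_of_mean_zero hvc hvp hvm
  refine ⟨fun z => U z - (∫ s in (0 : ℝ)..(2 * Real.pi), U s) / (2 * Real.pi), v,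
    fun z => s * v z + h z, fun z => s * (s * v z + h z) + (r * h z + f z / a),
    fun z => by simp [hUp z], ?_, fun z => (hUd z).sub_const _, hvd, hvd1, heq⟩
  rw [intervalIntegral.integral_sub (hUc.intervalIntegrable _ _) (by simp)]
  simp only [intervalIntegral.integral_const, sub_zero, smul_eq_mul]
  field_simp
  ring

/-! ### The averaged sine -/

theorem abs_meanSin_sub_le {u v : ℝ → ℝ} (hu : Continuous u) (hv : Continuous v) {D : ℝ}
    (h : ∀ z, |u z - v z| ≤ D) : |meanSin u - meanSin v| ≤ D := by
  have hi : ∀ {w : ℝ → ℝ}, Continuous w → IntervalIntegrable (fun s => Real.sin (s + w s)) volume 0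
      (2 * Real.pi) := fun hw => (by fun_prop : Continuous _).intervalIntegrable _ _
  have e := intervalIntegral.norm_integral_le_of_norm_le_const (a := 0) (b := 2 * Real.pi) (C := D)
    (f := fun s => Real.sin (s + u s) - Real.sin (s + v s)) fun s _ => by
      refine (Real.abs_sin_sub_sin_le _ _).trans ?_
      rw [add_sub_add_left_eq_sub]; exact h s
  rw [intervalIntegral.integral_sub (hi hu) (hi hv), Real.norm_eq_abs, sub_zero,
    abs_of_pos Real.two_pi_pos] at e
  rw [meanSin, meanSin, ← mul_sub, abs_mul, abs_of_pos (by positivity), one_div,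
    inv_mul_le_iff₀ Real.two_pi_pos, mul_comm _ D]
  exact e

theorem abs_meanSin_le_one (u : ℝ → ℝ) : |meanSin u| ≤ 1 := by
  have e := intervalIntegral.norm_integral_le_of_norm_le_const (a := 0) (b := 2 * Real.pi) (C := 1)
    (f := fun s => Real.sin (s + u s)) fun s _ => Real.abs_sin_le_one _
  rw [Real.norm_eq_abs, sub_zero, abs_of_pos Real.two_pi_pos] at e
  rw [meanSin, abs_mul, abs_of_pos (by positivity), one_div, inv_mul_le_iff₀ Real.two_pi_pos,
    mul_one]
  linarith

/-- The nonlinearity `sin (z + u z) - ⟨sin (s + u s)⟩`. -/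
noncomputable def sinFluctuation (u : ℝ → ℝ) (z : ℝ) : ℝ :=
  Real.sin (z + u z) - meanSin u

theorem continuous_sinFluctuation {u : ℝ → ℝ} (hu : Continuous u) :
    Continuous (sinFluctuation u) := by
  unfold sinFluctuation; fun_prop

theorem periodic_sinFluctuation {u : ℝ → ℝ} (hu : Function.Periodic u (2 * Real.pi)) :
    Function.Periodic (sinFluctuation u) (2 * Real.pi) := fun z => by
  simp only [sinFluctuation, hu z]
  rw [show z + 2 * Real.pi + u z = z + u z + 2 * Real.pi by ring, Real.sin_add_two_pi]

theorem integral_sinFluctuation {u : ℝ → ℝ} (hu : Continuous u) :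
    ∫ s in (0 : ℝ)..(2 * Real.pi), sinFluctuation u s = 0 := by
  simp only [sinFluctuation]
  rw [intervalIntegral.integral_sub ((by fun_prop : Continuous _).intervalIntegrable _ _) (by simp)]
  simp only [intervalIntegral.integral_const, sub_zero, smul_eq_mul, meanSin]
  field_simp
  ring

theorem abs_sinFluctuation_le (u : ℝ → ℝ) (z : ℝ) : |sinFluctuation u z| ≤ 2 := by
  have h1 := Real.abs_sin_le_one (z + u z)
  have h2 := abs_meanSin_le_one u
  calc _ ≤ |Real.sin (z + u z)| + |meanSin u| := abs_sub _ _
    _ ≤ 2 := by linarith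

theorem abs_sinFluctuation_sub_le {u v : ℝ → ℝ} (hu : Continuous u) (hv : Continuous v) {D : ℝ}
    (h : ∀ z, |u z - v z| ≤ D) (z : ℝ) :
    |sinFluctuation u z - sinFluctuation v z| ≤ 2 * D := by
  have h1 : |Real.sin (z + u z) - Real.sin (z + v z)| ≤ D := by
    refine (Real.abs_sin_sub_sin_le _ _).trans ?_
    rw [add_sub_add_left_eq_sub]; exact h z
  have h2 := abs_meanSin_sub_le hu hv h
  calc _ = |(Real.sin (z + u z) - Real.sin (z + v z)) - (meanSin u - meanSin v)| := by
        simp only [sinFluctuation]; ring_nf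
    _ ≤ |Real.sin (z + u z) - Real.sin (z + v z)| + |meanSin u - meanSin v| := abs_sub _ _
    _ ≤ 2 * D := by linarith

/-! ### The reduced equation: existence and comparison of solutions -/

/-- `u` is a classical mean-zero `2π`-periodic solution of
`a u''' + (lam κ² - 1/lam) u'' - α u' = lam (sin (z + u) - ⟨sin (s + u)⟩)`, with successive
derivatives `u₁`, `u₂`, `u₃`. -/
def IsReducedSolution (a κ α lam : ℝ) (u u₁ u₂ u₃ : ℝ → ℝ) : Prop :=
  IsPeriodicSolution a (1 / lam - lam * κ ^ 2) α (fun z => lam * sinFluctuation u z) u u₁ u₂ u₃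

open scoped BoundedContinuousFunction in
/-- The operator taking `f` to the solution with right-hand side `lam * sinFluctuation f` is a
contraction for the sup norm, with factor `4 π lam / α ≤ 1 / 2`. -/
theorem exists_isReducedSolution {a κ α lam : ℝ} (ha : 0 < a) (hα : 0 < α) (hlam : 0 < lam)
    (hsmall : 8 * Real.pi * lam ≤ α) :
    ∃ u u₁ u₂ u₃, IsReducedSolution a κ α lam u u₁ u₂ u₃ := by
  -- The solution operator acts on the complete space of continuous `2π`-periodic functions.
  let S : Set (ℝ →ᵇ ℝ) := {f | Function.Periodic f (2 * Real.pi)}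
  have hS : IsClosed S := by
    have : S = ⋂ z : ℝ, {f : ℝ →ᵇ ℝ | f (z + 2 * Real.pi) = f z} := by
      ext f; simp [S, Function.Periodic]
    rw [this]
    exact isClosed_iInter fun z => isClosed_eq
      (BoundedContinuousFunction.lipschitz_eval_const _).continuous
      (BoundedContinuousFunction.lipschitz_eval_const _).continuous
  have hcS : CompleteSpace S := hS.completeSpace_coe
  have hneS : Nonempty S := ⟨⟨0, fun z => rfl⟩⟩
  have key : ∀ f : S, ∃ U : S, ∃ u₁ u₂ u₃, IsPeriodicSolution a (1 / lam - lam * κ ^ 2) α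
      (fun z => lam * sinFluctuation (f : ℝ →ᵇ ℝ) z) (U : ℝ →ᵇ ℝ) u₁ u₂ u₃ := by
    intro f
    have hfc : Continuous (f : ℝ →ᵇ ℝ) := (f : ℝ →ᵇ ℝ).continuous
    obtain ⟨u, u₁, u₂, u₃, h⟩ := exists_isPeriodicSolution (b := 1 / lam - lam * κ ^ 2) ha hα
      ((continuous_sinFluctuation hfc).const_mul lam)
      (fun z => by rw [periodic_sinFluctuation f.2 z])
      (by rw [intervalIntegral.integral_const_mul, integral_sinFluctuation hfc, mul_zero])
    refine ⟨⟨BoundedContinuousFunction.ofNormedAddCommGroup u h.continuous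
      (2 * Real.pi * (lam * 2 / α)) fun z => ?_, h.periodic⟩, u₁, u₂, u₃, h⟩
    refine h.abs_le ha.le hα (fun z => ?_) z
    rw [abs_mul, abs_of_pos hlam]
    exact mul_le_mul_of_nonneg_left (abs_sinFluctuation_le _ _) hlam.le
  choose T hT using key
  have hcontr : ContractingWith (1 / 2) T := by
    refine ⟨by rw [← NNReal.coe_lt_coe]; norm_num, LipschitzWith.of_dist_le_mul fun f g => ?_⟩
    obtain ⟨u₁, u₂, u₃, hu⟩ := hT f
    obtain ⟨v₁, v₂, v₃, hv⟩ := hT g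
    have hfg : ∀ z, |(f : ℝ →ᵇ ℝ) z - (g : ℝ →ᵇ ℝ) z| ≤ dist f g := fun z =>
      BoundedContinuousFunction.dist_coe_le_dist (f := (f : ℝ →ᵇ ℝ)) (g := g) z
    refine (BoundedContinuousFunction.dist_le (by positivity)).2 fun z => ?_
    refine ((hu.sub hv).abs_le ha.le hα (M := lam * (2 * dist f g)) (fun z => ?_) z).trans ?_
    · rw [sub_self, zero_mul, add_zero, ← mul_sub, abs_mul, abs_of_pos hlam]
      exact mul_le_mul_of_nonneg_left (abs_sinFluctuation_sub_le (f : ℝ →ᵇ ℝ).continuous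
        (g : ℝ →ᵇ ℝ).continuous hfg z) hlam.le
    · have : 2 * Real.pi * (lam * (2 * dist f g) / α) = 8 * Real.pi * lam / α * (1 / 2 * dist f g) := by
        ring
      rw [this]
      push_cast
      exact mul_le_of_le_one_left (by positivity) ((div_le_one hα).2 hsmall)
  have hfix := hcontr.fixedPoint_isFixedPt
  obtain ⟨u₁, u₂, u₃, h⟩ := hT (hcontr.fixedPoint T)
  rw [hfix] at h
  exact ⟨_, u₁, u₂, u₃, h⟩

/-- Solutions at two small parameters differ by less than the variation of `α / lam` between
these parameters. For equal parameters, this is uniqueness. -/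
theorem abs_sub_mul_le_of_isReducedSolution {a κ α lam mu : ℝ} (ha : 0 < a) (hα : 0 < α)
    (hlam : 0 < lam) (hle : lam ≤ mu) (hmu : 8 * Real.pi * mu ≤ α) (hmu' : 2 * (mu * κ) ^ 2 ≤ 1)
    {u u₁ u₂ u₃ v v₁ v₂ v₃ : ℝ → ℝ} (hu : IsReducedSolution a κ α lam u u₁ u₂ u₃)
    (hv : IsReducedSolution a κ α mu v v₁ v₂ v₃) (z : ℝ) :
    |u z - v z| * (lam * mu) ≤ α / 2 * (mu - lam) := by
  have hmu0 : 0 < mu := hlam.trans_le hle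
  have hπ := Real.pi_gt_three
  obtain ⟨z₀, hz₀⟩ := exists_forall_le_of_periodic (v := fun z => |u z - v z|)
    (fun z => by simp [hu.periodic z, hv.periodic z]) (hu.continuous.sub hv.continuous).abs
  set D := |u z₀ - v z₀| with hD
  have hb : 1 / (2 * mu) ≤ 1 / mu - mu * κ ^ 2 := by
    have : 1 / mu - mu * κ ^ 2 - 1 / (2 * mu) = (1 - 2 * (mu * κ) ^ 2) / (2 * mu) := by
      field_simp; ring
    have h2 : 0 ≤ (1 - 2 * (mu * κ) ^ 2) / (2 * mu) := div_nonneg (by linarith) (by positivity)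
    linarith
  have hb0 : 0 < 1 / (2 * mu) := by positivity
  have hv2 : ∀ z, |v₂ z| ≤ 8 * mu ^ 2 := fun z => by
    refine (hv.abs_second_le ha.le (hb0.trans_le hb) hα (M := mu * 2) (fun z => ?_) z).trans ?_
    · rw [abs_mul, abs_of_pos hmu0]
      exact mul_le_mul_of_nonneg_left (abs_sinFluctuation_le _ _) hmu0.le
    · refine (div_le_div_of_nonneg_left (by positivity) hb0 hb).trans_eq ?_
      field_simp; ring
  have hM : ∀ z, |lam * sinFluctuation u z - mu * sinFluctuation v z +
      (1 / lam - lam * κ ^ 2 - (1 / mu - mu * κ ^ 2)) * v₂ z| ≤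
      lam * (2 * D) + (mu - lam) * 2 + (mu - lam) * (1 / (lam * mu) + κ ^ 2) * (8 * mu ^ 2) := by
    intro z
    have e : lam * sinFluctuation u z - mu * sinFluctuation v z +
        (1 / lam - lam * κ ^ 2 - (1 / mu - mu * κ ^ 2)) * v₂ z =
        lam * (sinFluctuation u z - sinFluctuation v z) + (-((mu - lam) * sinFluctuation v z)) +
          (mu - lam) * (1 / (lam * mu) + κ ^ 2) * v₂ z := by
      field_simp; ring
    have hd : 0 ≤ mu - lam := sub_nonneg.2 hle
    have hq : 0 ≤ (mu - lam) * (1 / (lam * mu) + κ ^ 2) := by positivity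
    rw [e]
    refine (abs_add_three _ _ _).trans ?_
    rw [abs_neg, abs_mul, abs_mul, abs_mul, abs_of_pos hlam, abs_of_nonneg hd, abs_of_nonneg hq]
    exact add_le_add (add_le_add (mul_le_mul_of_nonneg_left
      (abs_sinFluctuation_sub_le hu.continuous hv.continuous hz₀ z) hlam.le)
      (mul_le_mul_of_nonneg_left (abs_sinFluctuation_le v z) hd))
      (mul_le_mul_of_nonneg_left (hv2 z) hq)
  have hDle := (hu.sub hv).abs_le ha.le hα hM z₀
  rw [← hD] at hDle
  refine (mul_le_mul_of_nonneg_right (hz₀ z) (by positivity)).trans ?_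
  set E := D * (lam * mu) with hE
  have hE0 : 0 ≤ E := by positivity
  -- Clearing denominators, and absorbing the term with `D` into the left side.
  have h1 : α * E ≤ 4 * Real.pi * lam * E +
      2 * Real.pi * (mu - lam) * (2 * (lam * mu) + 8 * mu ^ 2 + 8 * (mu * κ) ^ 2 * (lam * mu)) := by
    have := mul_le_mul_of_nonneg_left hDle (show 0 ≤ α * (lam * mu) by positivity)
    calc α * E = α * (lam * mu) * D := by rw [hE]; ring
      _ ≤ _ := this
      _ = _ := by rw [hE]; field_simp; ring
  have h2 : 4 * Real.pi * lam * E ≤ α / 2 * E := by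
    refine mul_le_mul_of_nonneg_right ?_ hE0
    nlinarith
  have h3 : 2 * (lam * mu) + 8 * mu ^ 2 + 8 * (mu * κ) ^ 2 * (lam * mu) ≤ 14 * mu ^ 2 := by
    have : lam * mu ≤ mu ^ 2 := by nlinarith
    have : 8 * (mu * κ) ^ 2 * (lam * mu) ≤ 4 * (lam * mu) :=
      mul_le_mul_of_nonneg_right (by linarith) (by positivity)
    linarith
  have h4 : 2 * Real.pi * (mu - lam) *
      (2 * (lam * mu) + 8 * mu ^ 2 + 8 * (mu * κ) ^ 2 * (lam * mu)) ≤
      2 * Real.pi * (mu - lam) * (14 * mu ^ 2) :=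
    mul_le_mul_of_nonneg_left h3 (mul_nonneg (by positivity) (sub_nonneg.2 hle))
  have h5 : 2 * Real.pi * (14 * mu ^ 2) ≤ α ^ 2 / 4 := by
    have : (8 * Real.pi * mu) ^ 2 ≤ α ^ 2 := pow_le_pow_left₀ (by positivity) hmu 2
    nlinarith [mul_le_mul_of_nonneg_right hπ.le (show 0 ≤ Real.pi * mu ^ 2 by positivity)]
  have h6 := mul_le_mul_of_nonneg_right h5 (sub_nonneg.2 hle)
  have h7 : α / 2 * E ≤ α / 2 * (α / 2 * (mu - lam)) := by nlinarith
  exact le_of_mul_le_mul_left h7 (by positivity)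

theorem isReducedSolution_unique {a κ α lam : ℝ} (ha : 0 < a) (hα : 0 < α)
    (hlam : 0 < lam) (hsmall : 8 * Real.pi * lam ≤ α) (hsmall' : 2 * (lam * κ) ^ 2 ≤ 1)
    {u u₁ u₂ u₃ v v₁ v₂ v₃ : ℝ → ℝ} (hu : IsReducedSolution a κ α lam u u₁ u₂ u₃)
    (hv : IsReducedSolution a κ α lam v v₁ v₂ v₃) : u = v := by
  funext z
  have h := abs_sub_mul_le_of_isReducedSolution ha hα hlam le_rfl hsmall hsmall' hu hv z
  rw [sub_self, mul_zero] at h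
  have h0 : |u z - v z| ≤ 0 := nonpos_of_mul_nonpos_left h (by positivity)
  exact sub_eq_zero.1 (abs_nonpos_iff.1 h0)

theorem abs_meanSin_sub_mul_le_of_isReducedSolution {a κ α lam mu : ℝ} (ha : 0 < a) (hα : 0 < α)
    (hlam : 0 < lam) (hle : lam ≤ mu) (hmu : 8 * Real.pi * mu ≤ α) (hmu' : 2 * (mu * κ) ^ 2 ≤ 1)
    {u u₁ u₂ u₃ v v₁ v₂ v₃ : ℝ → ℝ} (hu : IsReducedSolution a κ α lam u u₁ u₂ u₃)
    (hv : IsReducedSolution a κ α mu v v₁ v₂ v₃) :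
    |meanSin u - meanSin v| ≤ 1 / 2 * (α / lam - α / mu) := by
  have hmu0 : 0 < mu := hlam.trans_le hle
  refine abs_meanSin_sub_le hu.continuous hv.continuous fun z => ?_
  have e : 1 / 2 * (α / lam - α / mu) = α / 2 * (mu - lam) / (lam * mu) := by field_simp
  rw [e, le_div_iff₀ (by positivity)]
  exact abs_sub_mul_le_of_isReducedSolution ha hα hlam hle hmu hmu' hu hv z

/-! ### Weak and classical solutions -/

/-- A weak solution is classical: the equation makes its weak third derivative continuous and
periodic, up to a null set. -/
theorem IsReducedFixedPoint.exists_isReducedSolution {L α β lam : ℝ} (hL : 0 < L) (hβ : 0 < β)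
    {u : ℝ → ℝ} (h : IsReducedFixedPoint L α β lam u) :
    ∃ u₁ u₂ u₃,
      IsReducedSolution (β * (2 * Real.pi / L) ^ 2) (2 * Real.pi / L) α lam u u₁ u₂ u₃ := by
  obtain ⟨w, hw, heq⟩ := h
  set κ := 2 * Real.pi / L with hκ
  have hκ0 : 0 < κ := by positivity
  have ha : 0 < β * κ ^ 2 := by positivity
  have hC1 : ContDiff ℝ 1 (deriv u) := by
    have := hw.contDiff
    rw [show (2 : WithTop ℕ∞) = 1 + 1 by norm_num, contDiff_succ_iff_deriv] at this
    exact this.2.2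
  have hd0 : ∀ z, HasDerivAt u (deriv u z) z := fun z =>
    (hw.contDiff.differentiable (by norm_num) z).hasDerivAt
  have h2 : iteratedDeriv 2 u = deriv (deriv u) := by
    rw [iteratedDeriv_succ, iteratedDeriv_one]
  have hd1 : ∀ z, HasDerivAt (deriv u) (iteratedDeriv 2 u z) z := fun z => by
    rw [h2]; exact (hC1.differentiable (by norm_num) z).hasDerivAt
  have hc2 : Continuous (iteratedDeriv 2 u) := by rw [h2]; exact hC1.continuous_deriv le_rfl
  have hc0 := hw.contDiff.continuous
  have hp0 := hw.periodic
  have hp1 := periodic_of_hasDerivAt hp0 hd0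
  have hp2 := periodic_of_hasDerivAt hp1 hd1
  -- The equation identifies the weak third derivative with a continuous periodic function.
  set g : ℝ → ℝ := fun z => (lam * sinFluctuation u z - (lam * κ ^ 2 - 1 / lam) * iteratedDeriv 2 u z
    + α * deriv u z) / (β * κ ^ 2) with hg
  have hgc : Continuous g := by
    have := continuous_sinFluctuation hc0
    have := hC1.continuous
    fun_prop
  have hgp : Function.Periodic g (2 * Real.pi) := fun z => by
    simp only [hg, hp1 z, hp2 z, periodic_sinFluctuation hp0 z]
  have hwg : w =ᵐ[volume.restrict (Ioc 0 (2 * Real.pi))] g := by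
    filter_upwards [heq] with z hz
    rw [hg]
    simp only [sinFluctuation]
    rw [← hz]
    field_simp
    ring
  have hint : ∀ z ∈ Icc 0 (2 * Real.pi),
      iteratedDeriv 2 u z = iteratedDeriv 2 u 0 + ∫ s in (0 : ℝ)..z, g s := fun z hz => by
    rw [hw.integral_third z hz, intervalIntegral.integral_of_le hz.1,
      intervalIntegral.integral_of_le hz.1]
    congr 1
    exact integral_congr_ae (ae_mono (Measure.restrict_mono (Ioc_subset_Ioc_right hz.2) le_rfl) hwg)
  have hgm : ∫ s in (0 : ℝ)..(2 * Real.pi), g s = 0 := by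
    have e1 := hint (2 * Real.pi) (right_mem_Icc.2 Real.two_pi_pos.le)
    have e2 := hp2 0
    rw [zero_add] at e2
    linarith
  have hall : iteratedDeriv 2 u = fun z => iteratedDeriv 2 u 0 + ∫ s in (0 : ℝ)..z, g s := by
    funext z
    have hP := hp2.sub (periodic_integral_of_mean_zero hgc hgp hgm)
    obtain ⟨y, hy, e⟩ := hP.exists_mem_Ico₀ Real.two_pi_pos z
    simp only [Pi.sub_apply] at e
    linarith [hint y (Ico_subset_Icc_self hy)]
  have hd2 : ∀ z, HasDerivAt (iteratedDeriv 2 u) (g z) z := fun z => by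
    rw [hall]
    exact (hgc.integral_hasStrictDerivAt 0 z).hasDerivAt.const_add _
  refine ⟨deriv u, iteratedDeriv 2 u, g, hp0, hw.mean_zero, hd0, hd1, hd2, fun z => ?_⟩
  simp only [hg]
  rw [mul_div_cancel₀ _ ha.ne']
  ring

theorem IsReducedSolution.isReducedFixedPoint {L α β lam : ℝ} (hL : 0 < L) (hβ : 0 < β)
    {u u₁ u₂ u₃ : ℝ → ℝ}
    (h : IsReducedSolution (β * (2 * Real.pi / L) ^ 2) (2 * Real.pi / L) α lam u u₁ u₂ u₃) :
    IsReducedFixedPoint L α β lam u := by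
  have e1 : deriv u = u₁ := funext fun z => (h.hasDerivAt z).deriv
  have e2 : iteratedDeriv 2 u = u₂ := by
    rw [iteratedDeriv_succ, iteratedDeriv_one, e1]
    exact funext fun z => (h.hasDerivAt₁ z).deriv
  have hc1 := continuous_of_forall_hasDerivAt h.hasDerivAt₁
  have hc2 := continuous_of_forall_hasDerivAt h.hasDerivAt₂
  have hc3 : Continuous u₃ := by
    have ha : β * (2 * Real.pi / L) ^ 2 ≠ 0 := by positivity
    have : u₃ = fun z => (lam * sinFluctuation u z + (1 / lam - lam * (2 * Real.pi / L) ^ 2) * u₂ z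
        + α * u₁ z) / (β * (2 * Real.pi / L) ^ 2) := funext fun z => by
      rw [eq_div_iff ha]; linear_combination h.eq z
    rw [this]
    have := continuous_sinFluctuation h.continuous
    fun_prop
  refine ⟨u₃, ⟨h.periodic, ?_, ?_, fun z _ => ?_, h.mean_zero⟩, ?_⟩
  · rw [show (2 : WithTop ℕ∞) = 1 + 1 by norm_num, contDiff_succ_iff_deriv, e1,
      contDiff_one_iff_deriv]
    refine ⟨fun z => (h.hasDerivAt z).differentiableAt, by simp,
      fun z => (h.hasDerivAt₁ z).differentiableAt, ?_⟩
    rwa [show deriv u₁ = u₂ from funext fun z => (h.hasDerivAt₁ z).deriv]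
  · obtain ⟨C, hC⟩ := (isCompact_Icc (a := (0 : ℝ)) (b := 2 * Real.pi)).exists_bound_of_continuousOn
      hc3.continuousOn
    refine MemLp.of_bound hc3.aestronglyMeasurable C ?_
    exact (ae_restrict_iff' measurableSet_Ioc).2
      (Filter.Eventually.of_forall fun z hz => hC z (Ioc_subset_Icc_self hz))
  · rw [e2, intervalIntegral.integral_eq_sub_of_hasDerivAt (fun z _ => h.hasDerivAt₂ z)
      (hc3.intervalIntegrable _ _)]
    ring
  · refine Filter.Eventually.of_forall fun z => ?_
    rw [e1, e2]
    have := h.eq z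
    simp only [sinFluctuation] at this
    linarith

/-! ### Rotating waves and the reduced equation -/

theorem IsReducedSolution.isRotatingFluxonWave {L α β γ lam : ℝ} (hL : 0 < L) (hlam : 0 < lam)
    {u u₁ u₂ u₃ : ℝ → ℝ}
    (h : IsReducedSolution (β * (2 * Real.pi / L) ^ 2) (2 * Real.pi / L) α lam u u₁ u₂ u₃)
    (hγ : biasFunctional α lam u = γ) :
    IsRotatingFluxonWave L α β γ (1 / lam) fun x t =>
      (2 * Real.pi / L * x + 1 / lam * t) + u (2 * Real.pi / L * x + 1 / lam * t) := by
  set κ := 2 * Real.pi / L with hκ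
  set ω := 1 / lam with hω
  have hθ : ∀ z, HasDerivAt (fun z => z + u z) (1 + u₁ z) z := fun z =>
    (hasDerivAt_id z).add (h.hasDerivAt z)
  have hθ1 : ∀ z, HasDerivAt (fun z => 1 + u₁ z) (u₂ z) z := fun z => (h.hasDerivAt₁ z).const_add 1
  have ht : ∀ x t, HasDerivAt (fun s => κ * x + ω * s) ω t := fun x t => by
    simpa using ((hasDerivAt_id t).const_mul ω).const_add (κ * x)
  have hx : ∀ x t, HasDerivAt (fun y => κ * y + ω * t) κ x := fun x t => by
    simpa using ((hasDerivAt_id x).const_mul κ).add_const (ω * t)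
  refine ⟨⟨fun x t => (1 + u₁ (κ * x + ω * t)) * ω, fun x t => u₂ (κ * x + ω * t) * ω * ω,
    fun x t => (1 + u₁ (κ * x + ω * t)) * κ, fun x t => u₂ (κ * x + ω * t) * κ * κ,
    fun x t => u₃ (κ * x + ω * t) * ω * κ * κ, fun x t => ?_, fun x t => ?_, fun x t => ?_,
    fun x t => ?_, fun x t => ?_, fun x t => ?_⟩, fun x t => ?_, κ, fun z => z + u z,
    fun z => ?_, fun x t => rfl⟩
  · exact (hθ _).comp t (ht x t)
  · exact ((hθ1 _).comp t (ht x t)).mul_const ω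
  · exact (hθ _).comp x (hx x t)
  · exact ((hθ1 _).comp x (hx x t)).mul_const κ
  · exact ((((h.hasDerivAt₂ _).comp t (ht x t)).mul_const κ).mul_const κ)
  · have e := h.eq (κ * x + ω * t)
    simp only [sinFluctuation] at e
    rw [← hγ, biasFunctional, hω]
    rw [hω] at e
    field_simp at e ⊢
    linear_combination -e
  · have : κ * (x + L) + ω * t = κ * x + ω * t + 2 * Real.pi := by rw [hκ]; field_simp; ring
    simp only [this, h.periodic _]; ring
  · simp only [h.periodic _]; ring

/-- For a bias larger than `1`, the profile of a rotating wave, translated so that its deviation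
from the identity has mean zero, solves the reduced equation with parameter `1 / ω`. -/
theorem IsRotatingFluxonWave.exists_isReducedSolution {L α β γ ω : ℝ} (hL : 0 < L) (hα : 0 < α)
    (hγ : 1 < γ) {φ : ℝ → ℝ → ℝ} (h : IsRotatingFluxonWave L α β γ ω φ) :
    0 < ω ∧ ∃ (m : ℝ) (u u₁ u₂ u₃ : ℝ → ℝ),
      IsReducedSolution (β * (2 * Real.pi / L) ^ 2) (2 * Real.pi / L) α (1 / ω) u u₁ u₂ u₃ ∧
      biasFunctional α (1 / ω) u = γ ∧
      ∀ x t, φ x t = (2 * Real.pi / L * x + ω * t + m) + u (2 * Real.pi / L * x + ω * t + m) := by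
  obtain ⟨⟨φt, φtt, φx, φxx, φxxt, ht, htt, hx, hxx, hxxt, heq⟩, hper, κ, θ, hθper, hφ⟩ := h
  have hκ0 : κ ≠ 0 := by
    rintro rfl
    have := hper 0 0
    rw [hφ, hφ] at this
    simp [Real.pi_ne_zero] at this
  set θ₁ : ℝ → ℝ := fun z => φx (z / κ) 0 / κ with hθ₁
  set θ₂ : ℝ → ℝ := fun z => φxx (z / κ) 0 / κ / κ with hθ₂
  have hdiv : ∀ z, HasDerivAt (fun z => z / κ) (1 / κ) z := fun z => (hasDerivAt_id z).div_const κ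
  have hθd : ∀ z, HasDerivAt θ (θ₁ z) z := fun z => by
    have e : θ = (fun y => φ y 0) ∘ fun z => z / κ := funext fun z => by
      simp only [Function.comp, hφ]; congr 1; field_simp; ring
    rw [e, hθ₁]
    exact ((hx (z / κ) 0).comp z (hdiv z)).congr_deriv (by ring)
  have hθ₁d : ∀ z, HasDerivAt θ₁ (θ₂ z) z := fun z =>
    ((HasDerivAt.comp (h₂ := fun y => φx y 0) z (hxx (z / κ) 0) (hdiv z)).div_const
      κ).congr_deriv (by simp only [hθ₂]; ring)
  have hline : ∀ x t, HasDerivAt (fun s => κ * x + ω * s) ω t := fun x t => by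
    simpa using ((hasDerivAt_id t).const_mul ω).const_add (κ * x)
  have hline' : ∀ x t, HasDerivAt (fun y => κ * y + ω * t) κ x := fun x t => by
    simpa using ((hasDerivAt_id x).const_mul κ).add_const (ω * t)
  -- The deviation of the profile from the identity is periodic.
  have hp : Function.Periodic (fun z => θ z - z) (2 * Real.pi) := fun z => by
    simp only [hθper]; ring
  have hpc : Continuous fun z => θ z - z := (continuous_of_forall_hasDerivAt hθd).sub continuous_id
  have hκ : κ = 2 * Real.pi / L := by
    rw [eq_div_iff hL.ne']
    have hs : ∀ z, θ (z + κ * L) = θ z + 2 * Real.pi := fun z => by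
      have := hper (z / κ) 0
      rw [hφ, hφ, show κ * (z / κ + L) + ω * 0 = z + κ * L by field_simp; ring,
        show κ * (z / κ) + ω * 0 = z by field_simp; ring] at this
      exact this
    -- Translations by `± κ L` add `± (2π - κ L)` to the deviation, which has a maximum.
    obtain ⟨z₀, hz₀⟩ := exists_forall_le_of_periodic hp hpc
    have h1 := hz₀ (z₀ + κ * L)
    have h2 := hz₀ (z₀ - κ * L)
    have h3 := hs (z₀ - κ * L)
    rw [hs] at h1
    rw [sub_add_cancel] at h3
    linarith
  have hθ₁p : Function.Periodic θ₁ (2 * Real.pi) := fun z => by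
    have := periodic_of_hasDerivAt hp (fun z => (hθd z).sub (hasDerivAt_id z)) z
    simpa using this
  have hθ₂p := periodic_of_hasDerivAt hθ₁p hθ₁d
  have hφt : ∀ x t, φt x t = θ₁ (κ * x + ω * t) * ω := fun x t =>
    (ht x t).unique (by
      rw [show (fun s => φ x s) = θ ∘ fun s => κ * x + ω * s from funext fun s => hφ x s]
      exact (hθd _).comp t (hline x t))
  have hφtt : ∀ x t, φtt x t = θ₂ (κ * x + ω * t) * ω * ω := fun x t =>
    (htt x t).unique (by
      rw [show (fun s => φt x s) = fun s => θ₁ (κ * x + ω * s) * ω from funext fun s => hφt x s]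
      exact ((hθ₁d _).comp t (hline x t)).mul_const ω)
  have hφx : ∀ x t, φx x t = θ₁ (κ * x + ω * t) * κ := fun x t =>
    (hx x t).unique (by
      rw [show (fun y => φ y t) = θ ∘ fun y => κ * y + ω * t from funext fun y => hφ y t]
      exact (hθd _).comp x (hline' x t))
  have hφxx : ∀ x t, φxx x t = θ₂ (κ * x + ω * t) * κ * κ := fun x t =>
    (hxx x t).unique (by
      rw [show (fun y => φx y t) = fun y => θ₁ (κ * y + ω * t) * κ from funext fun y => hφx y t]
      exact ((hθ₁d _).comp x (hline' x t)).mul_const κ)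
  have hω0 : ω ≠ 0 := by
    rintro rfl
    -- A static profile would be strictly concave when `γ > 1`, but its derivative is periodic.
    have hneg : ∀ z, θ₂ z < 0 := fun z => by
      have e1 : φxxt (z / κ) 0 = 0 := (hxxt (z / κ) 0).unique (by
        simp only [hφxx, zero_mul]; exact hasDerivAt_const _ _)
      have e2 := heq (z / κ) 0
      rw [hφtt, hφt, hφxx, e1, hφ, show κ * (z / κ) + 0 * 0 = z by field_simp; ring] at e2
      have e3 : θ₂ z * κ ^ 2 < 0 := by linarith [Real.sin_le_one (θ z)]
      exact (neg_iff_pos_of_mul_neg e3).2 (by positivity)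
    have := strictAnti_of_hasDerivAt_neg hθ₁d hneg Real.two_pi_pos
    rw [← zero_add (2 * Real.pi), hθ₁p] at this
    exact this.false
  set θ₃ : ℝ → ℝ := fun z => φxxt 0 (z / ω) / κ / κ / ω with hθ₃
  have hθ₂d : ∀ z, HasDerivAt θ₂ (θ₃ z) z := fun z => by
    have e : θ₂ = fun z => ((fun t => φxx 0 t) ∘ fun z => z / ω) z / κ / κ := funext fun z => by
      simp only [Function.comp, hφxx]
      rw [show κ * 0 + ω * (z / ω) = z by field_simp; ring]
      field_simp
    rw [e]
    exact (((((hxxt 0 (z / ω)).comp z ((hasDerivAt_id z).div_const ω)).div_const κ).div_const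
      κ)).congr_deriv (by simp only [hθ₃]; ring)
  have hprof : ∀ z, θ₂ z * ω * ω + α * (θ₁ z * ω) + Real.sin (θ z) =
      θ₂ z * κ * κ + β * (θ₃ z * κ * κ * ω) + γ := fun z => by
    have e2 := heq 0 (z / ω)
    rw [hφtt, hφt, hφxx, hφ, show κ * 0 + ω * (z / ω) = z by field_simp; ring] at e2
    rw [e2, hθ₃]
    field_simp
  -- Translate the profile so that the deviation from the identity has mean zero.
  set m : ℝ := (∫ s in (0 : ℝ)..(2 * Real.pi), (θ s - s)) / (2 * Real.pi) with hm
  set u : ℝ → ℝ := fun z => θ (z - m) - z with hu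
  have hshift : ∀ {v v₁ : ℝ → ℝ}, (∀ z, HasDerivAt v (v₁ z) z) →
      ∀ z, HasDerivAt (fun z => v (z - m)) (v₁ (z - m)) z := fun hv z =>
    (hv (z - m)).comp_sub_const z m
  have hud : ∀ z, HasDerivAt u (θ₁ (z - m) - 1) z := fun z => (hshift hθd z).sub (hasDerivAt_id z)
  have hud1 : ∀ z, HasDerivAt (fun z => θ₁ (z - m) - 1) (θ₂ (z - m)) z := fun z =>
    (hshift hθ₁d z).sub_const 1
  have hup : Function.Periodic u (2 * Real.pi) := fun z => by
    simp only [hu]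
    rw [show z + 2 * Real.pi - m = z - m + 2 * Real.pi by ring, hθper]; ring
  have huc : Continuous u := continuous_of_forall_hasDerivAt hud
  have hum : ∫ s in (0 : ℝ)..(2 * Real.pi), u s = 0 := by
    have e : u = fun z => (fun y => θ y - y) (z - m) - m := funext fun z => by simp only [hu]; ring
    have hi : Continuous fun z => (fun y => θ y - y) (z - m) := hpc.comp (continuous_sub_right m)
    rw [e, intervalIntegral.integral_sub (hi.intervalIntegrable _ _) (by simp),
      intervalIntegral.integral_comp_sub_right (fun y => θ y - y) m,
      show 2 * Real.pi - m = 0 - m + 2 * Real.pi by ring, hp.intervalIntegral_add_eq (0 - m) 0, zero_add]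
    simp only [intervalIntegral.integral_const, sub_zero, smul_eq_mul, hm]
    field_simp
    ring
  have hsin : ∀ z, Real.sin (θ (z - m)) = Real.sin (z + u z) := fun z => by simp [hu]
  -- Averaging the profile equation over a period.
  have hmean : α * ω + meanSin u = γ := by
    have hF : ∀ z, HasDerivAt (fun z => β * κ * κ * ω * θ₂ (z - m) +
        (κ * κ - ω * ω) * (θ₁ (z - m) - 1) - α * ω * u z) (Real.sin (z + u z) + (α * ω - γ)) z := fun z =>
      ((((hshift hθ₂d z).const_mul (β * κ * κ * ω)).add ((hud1 z).const_mul _)).sub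
        ((hud z).const_mul _)).congr_deriv (by
          rw [← hsin]; linear_combination -hprof (z - m))
    have e := intervalIntegral.integral_eq_sub_of_hasDerivAt (a := 0) (b := 2 * Real.pi)
      (fun z _ => hF z) ((by fun_prop : Continuous _).intervalIntegrable _ _)
    rw [intervalIntegral.integral_add ((by fun_prop : Continuous _).intervalIntegrable _ _) (by simp),
      show 2 * Real.pi - m = 0 - m + 2 * Real.pi by ring, hθ₁p, hθ₂p, ← zero_add (2 * Real.pi), hup,
      sub_self] at e
    simp only [intervalIntegral.integral_const, sub_zero, smul_eq_mul, zero_add] at e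
    rw [meanSin]
    have : ∫ s in (0 : ℝ)..(2 * Real.pi), Real.sin (s + u s) = -(2 * Real.pi * (α * ω - γ)) := by
      linarith
    rw [this]
    field_simp
    ring
  have hω : 0 < ω := by
    have := (abs_le.1 (abs_meanSin_le_one u)).2
    exact pos_of_mul_pos_right (by linarith : 0 < α * ω) hα.le
  refine ⟨hω, m, u, fun z => θ₁ (z - m) - 1, fun z => θ₂ (z - m), fun z => θ₃ (z - m),
    ⟨hup, hum, hud, hud1, hshift hθ₂d, fun z => ?_⟩, ?_, fun x t => ?_⟩
  · simp only [sinFluctuation]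
    rw [← hκ, eq_sub_of_add_eq' hmean, ← hsin]
    field_simp
    linear_combination -hprof (z - m)
  · rw [biasFunctional, ← hmean]; field_simp
  · rw [hφ, ← hκ]; simp [hu]

/-! ### Existence and uniqueness of rotating waves -/

theorem theorem4 (L α β : ℝ) (hL : 0 < L) (hα : 0 < α) (hβ : 0 < β) :
    (∃ γ₀ : ℝ, 0 < γ₀ ∧ ∀ γ : ℝ, γ₀ < γ →
      ∃ (ω : ℝ) (φ : ℝ → ℝ → ℝ), 0 < ω ∧ IsRotatingFluxonWave L α β γ ω φ ∧
        ∀ (ω' : ℝ) (φ' : ℝ → ℝ → ℝ), IsRotatingFluxonWave L α β γ ω' φ' →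
          ω' = ω ∧ ∃ τ : ℝ, ∀ x t, φ' x t = φ x (t + τ)) ∧
    (∃ lam₁ : ℝ, 0 < lam₁ ∧ ∃ u : ℝ → ℝ → ℝ,
      (∀ lam ∈ Ioo 0 lam₁, IsReducedFixedPoint L α β lam (u lam) ∧
        ∀ v : ℝ → ℝ, IsReducedFixedPoint L α β lam v → v = u lam) ∧
      StrictAntiOn (fun lam => biasFunctional α lam (u lam)) (Ioo 0 lam₁)) := by
  set κ := 2 * Real.pi / L with hκ
  have hκ0 : 0 < κ := by positivity
  have ha : 0 < β * κ ^ 2 := by positivity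
  set lam₁ := min (α / (8 * Real.pi)) (1 / (2 * κ)) with hlam₁
  have hlam₁0 : 0 < lam₁ := by positivity
  have hs1 : ∀ lam ∈ Ioo 0 lam₁, 8 * Real.pi * lam ≤ α := fun lam h => by
    have := h.2.le.trans (min_le_left _ _)
    rw [le_div_iff₀ (by positivity)] at this
    linarith
  have hs2 : ∀ lam ∈ Ioo 0 lam₁, 2 * (lam * κ) ^ 2 ≤ 1 := fun lam h => by
    have h1 := h.2.le.trans (min_le_right _ _)
    rw [le_div_iff₀ (by positivity)] at h1
    nlinarith [mul_pos h.1 hκ0]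
  have hex : ∀ lam, ∃ u u₁ u₂ u₃, lam ∈ Ioo 0 lam₁ →
      IsReducedSolution (β * κ ^ 2) κ α lam u u₁ u₂ u₃ := fun lam => by
    by_cases h : lam ∈ Ioo 0 lam₁
    · obtain ⟨u, u₁, u₂, u₃, hu⟩ := exists_isReducedSolution (κ := κ) ha hα h.1 (hs1 lam h)
      exact ⟨u, u₁, u₂, u₃, fun _ => hu⟩
    · exact ⟨0, 0, 0, 0, fun h' => absurd h' h⟩
  choose u u₁ u₂ u₃ hu using hex
  set Ψ : ℝ → ℝ := fun lam => biasFunctional α lam (u lam) with hΨ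
  have hcomp : ∀ {lam mu}, lam ∈ Ioo 0 lam₁ → mu ∈ Ioo 0 lam₁ → lam ≤ mu →
      |meanSin (u lam) - meanSin (u mu)| ≤ 1 / 2 * (α / lam - α / mu) := fun {lam mu} hl hm hle =>
    abs_meanSin_sub_mul_le_of_isReducedSolution ha hα hl.1 hle (hs1 mu hm) (hs2 mu hm)
      (hu lam hl) (hu mu hm)
  have hanti : StrictAntiOn Ψ (Ioo 0 lam₁) := fun lam hl mu hm hlt => by
    have h1 := (abs_le.1 (hcomp hl hm hlt.le)).1
    have h2 : α / mu < α / lam := div_lt_div_of_pos_left hα hl.1 hlt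
    simp only [hΨ, biasFunctional]
    linarith
  have hcont : ContinuousOn Ψ (Ioo 0 lam₁) := by
    intro mu hm
    have hle : ∀ lam ∈ Ioo 0 lam₁, dist (meanSin (u lam)) (meanSin (u mu)) ≤ |α / lam - α / mu| := by
      intro lam hl
      rw [Real.dist_eq]
      rcases le_total lam mu with h | h
      · have := hcomp hl hm h
        linarith [le_abs_self (α / lam - α / mu), abs_nonneg (α / lam - α / mu)]
      · have := hcomp hm hl h
        rw [abs_sub_comm] at this
        linarith [neg_le_abs (α / lam - α / mu), abs_nonneg (α / lam - α / mu)]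
    have hdivc : ContinuousWithinAt (fun lam => α / lam) (Ioo 0 lam₁) mu :=
      (continuousAt_const.div continuousAt_id hm.1.ne').continuousWithinAt
    refine hdivc.add ?_
    rw [ContinuousWithinAt, tendsto_iff_dist_tendsto_zero]
    have hlim := (hdivc.sub (continuousWithinAt_const (b := α / mu))).abs.tendsto
    simp only [Pi.sub_apply, sub_self, abs_zero] at hlim
    refine squeeze_zero' (Filter.Eventually.of_forall fun _ => dist_nonneg) ?_ hlim
    filter_upwards [self_mem_nhdsWithin] with lam hl using hle lam hl
  refine ⟨⟨max (Ψ (lam₁ / 2)) (1 + α / lam₁), by positivity, fun γ hγ => ?_⟩, lam₁, hlam₁0, u,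
    fun lam hl => ⟨(hu lam hl).isReducedFixedPoint hL hβ, fun v hv => ?_⟩, hanti⟩
  · have hγ1 := (le_max_left _ _).trans_lt hγ
    have hγ2 := (le_max_right _ _).trans_lt hγ
    have hγ0 : 1 < γ := by linarith [div_pos hα hlam₁0]
    -- The bias functional exceeds `γ` at `ε`, since it is at least `α / ε - 1`.
    obtain ⟨lam, hl, hlγ⟩ : ∃ lam ∈ Ioo 0 lam₁, Ψ lam = γ := by
      set ε := min (lam₁ / 2) (α / (γ + 1)) with hε
      have hε0 : 0 < ε := by positivity
      have hεm : ε ∈ Ioo 0 lam₁ := ⟨hε0, (min_le_left _ _).trans_lt (half_lt_self hlam₁0)⟩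
      have hsub : Icc ε (lam₁ / 2) ⊆ Ioo 0 lam₁ := fun x hx =>
        ⟨hε0.trans_le hx.1, hx.2.trans_lt (half_lt_self hlam₁0)⟩
      have hΨε : γ ≤ Ψ ε := by
        have h1 : γ + 1 ≤ α / ε := by
          rw [le_div_iff₀ hε0, mul_comm, ← le_div_iff₀ (by linarith)]
          exact min_le_right _ _
        have h2 := (abs_le.1 (abs_meanSin_le_one (u ε))).1
        simp only [hΨ, biasFunctional]
        linarith
      obtain ⟨lam, hl, e⟩ := intermediate_value_Icc' (min_le_left _ _) (hcont.mono hsub)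
        ⟨hγ1.le, hΨε⟩
      exact ⟨lam, hsub hl, e⟩
    refine ⟨1 / lam, _, one_div_pos.2 hl.1, (hu lam hl).isRotatingFluxonWave hL hl.1 hlγ,
      fun ω' φ' h' => ?_⟩
    obtain ⟨hω', m, v, v₁, v₂, v₃, hv, hvγ, hφ'⟩ := h'.exists_isReducedSolution hL hα hγ0
    have hmu : 1 / ω' ∈ Ioo 0 lam₁ := by
      refine ⟨one_div_pos.2 hω', ?_⟩
      have h1 := (abs_le.1 (abs_meanSin_le_one v)).2
      rw [biasFunctional] at hvγ
      by_contra! h2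
      have h3 : α / (1 / ω') ≤ α / lam₁ := div_le_div_of_nonneg_left hα.le hlam₁0 h2
      linarith
    have hvu : v = u (1 / ω') := isReducedSolution_unique ha hα hmu.1 (hs1 _ hmu) (hs2 _ hmu) hv
      (hu _ hmu)
    have he : 1 / ω' = lam := hanti.injOn hmu hl (by rw [hlγ, ← hvγ, hvu])
    have hω : ω' = 1 / lam := by rw [← he, one_div_one_div]
    refine ⟨hω, m * lam, fun x t => ?_⟩
    have hlam0 := hl.1.ne'
    rw [hφ', hvu, he, hω, show κ * x + 1 / lam * t + m = κ * x + 1 / lam * (t + m * lam) by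
      field_simp; ring]
  · obtain ⟨v₁, v₂, v₃, hv'⟩ := hv.exists_isReducedSolution hL hβ
    exact isReducedSolution_unique ha hα hl.1 (hs1 lam hl) (hs2 lam hl) hv' (hu lam hl)
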